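/- **Theorem (strong convergence with exact data).** Let $X, Y$ be real Hilbert spaces and let $\mathcal R: X \to (-\infty,\infty]$ be proper, lower semi-continuous and strongly convex: for some $\sigma>0$, $$\mathcal R(t\bar x+(1-t)x)+\sigma t(1-t)\|\bar x-x\|^2\le t\mathcal R(\bar x)+(1-t)\mathcal R(x)$$ for all $\bar x,x\in\mathrm{dom}(\mathcal R)$, $0\le t\le 1$. For $\xi\in\partial\mathcal R(x)$ write $D_{\mathcal R}^{\xi}(z,x)=\mathcal R(z)-\mathcal R(x)-\langle\xi,z-x\rangle$, and let $B_r(x_0)=\{x:\|x-x_0\|\le r\}$. Let $F:\mathrm{dom}(F)\subset X\to Y$ and $y\in Y$, and assume: * there are $\rho>0$, $x_0\in X$, $\xi_0\in\partial\mathcal R(x_0)$ such that $B_{2\rho}(x_0)\subset\mathrm{dom}(F)$ and $F(x)=y$ has a solution $\bar x$ with $D_{\mathcal R}^{\xi_0}(\bar x,x_0)\le\sigma\rho^2$; * if $u_n\in\mathrm{dom}(F)$, $u_n\rightharpoonup x$ weakly in $X$ and $F(u_n)\to v$ in $Y$, then $x\in\mathrm{dom}(F)$ and $F(x)=v$; *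 there are bounded linear operators $L(x):X\to Y$, $x\in B_{2\rho}(x_0)$, depending continuously on $x$ in operator norm, and constants $0\le\eta<1$, $L>0$ with $\|L(x)\|\le L$ and $\|F(x)-F(\bar x)-L(\bar x)(x-\bar x)\|\le\eta\|F(x)-F(\bar x)\|$ for all $x,\bar x\in B_{2\rho}(x_0)$. Let $0<\mu_0<4\sigma(1-\eta)$, $\mu_1>0$ and $0<\beta<1$. Starting from $\xi_{-1}=\xi_0$, define for $n\ge 0$: $x_n=\arg\min_{z\in X}\{\mathcal R(z)-\langle\xi_n,z\rangle\}$, $r_n=F(x_n)-y$, $g_n=L(x_n)^*r_n$, $m_n=\xi_n-\xi_{n-1}$; $$\alpha_n=\frac{\mu_0}{L^2}\quad\text{or}\quad\alpha_n=\begin{cases}\min\{\mu_0\|r_n\|^2/\|g_n\|^2,\ \mu_1\}& r_n\ne0,\\ 0& r_n=0;\end{cases}$$ $\tilde\gamma_0=0$ and $\tilde\gamma_n=\langle m_n,x_n-x_{n-1}\rangle-(1-\eta)\alpha_{n-1}\|r_{n-1}\|^2+\beta_{n-1}\tilde\gamma_{n-1}$ for $n\ge1$; $$\beta_n=\begin{cases}\min\left\{\max\left\{0,\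 \dfrac{\alpha_n\langle g_n,m_n\rangle-2\sigma\tilde\gamma_n}{\|m_n\|^2}\right\},\ \beta\right\}& m_n\ne0,\\ 0& m_n=0;\end{cases}$$ and $\xi_{n+1}=\xi_n-\alpha_ng_n+\beta_nm_n$. (Either rule for $\alpha_n$ may be used at each step.) Then the iteration is well defined (each minimization problem has exactly one solution, and $x_n\in B_{2\rho}(x_0)$ for all $n$), there is a unique solution $x^\dagger$ of $F(x)=y$ minimizing $D_{\mathcal R}^{\xi_0}(\cdot,x_0)$ among all solutions in $\mathrm{dom}(F)$, and there exists a solution $x^*$ of $F(x)=y$ in $B_{2\rho}(x_0)$ such that $$\lim_{n\to\infty}D_{\mathcal R}^{\xi_n}(x^*,x_n)=0\quad\text{and}\quad\lim_{n\to\infty}\|x_n-x^*\|=0.$$ If, in addition, $\mathrm{Ker}(L(x^\dagger))\subset\mathrm{Ker}(L(x))$ for all $x\in B_{2\rho}(x_0)$, then $x^*=x^\dagger$. -/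

import Mathlib

open Filter Topology Metric

noncomputable section

namespace AHB

variable {X Y : Type*} [NormedAddCommGroup X] [InnerProductSpace ℝ X] [CompleteSpace X]
  [NormedAddCommGroup Y] [InnerProductSpace ℝ Y] [CompleteSpace Y]

/-- The convex-analytic subdifferential `∂R(x)` of an extended real valued function on a Hilbert
space, as a subset of the space itself. -/
def subdifferential (R : X → EReal) (x : X) : Set X :=
  {ξ | ∀ z, R x + ((inner ℝ ξ (z - x) : ℝ) : EReal) ≤ R z}

/-- The Bregman distance `D_R^ξ(z, x) = R(z) - R(x) - ⟨ξ, z - x⟩`. -/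
def bregman (R : X → EReal) (ξ z x : X) : EReal :=
  R z - R x - ((inner ℝ ξ (z - x) : ℝ) : EReal)

/-- `R : X → (-∞, ∞]` is proper, lower semi-continuous, and strongly convex with constant `σ`. -/
structure RegFunctional (R : X → EReal) (σ : ℝ) : Prop where
  ne_bot : ∀ x, R x ≠ ⊥
  proper : ∃ x, R x ≠ ⊤
  lsc : LowerSemicontinuous R
  sigma_pos : 0 < σ
  strongly_convex : ∀ x' x : X, R x' ≠ ⊤ → R x ≠ ⊤ → ∀ t : ℝ, 0 ≤ t → t ≤ 1 →
    R (t • x' + (1 - t) • x) + ((σ * t * (1 - t) * ‖x' - x‖ ^ 2 : ℝ) : EReal)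
      ≤ (t : EReal) * R x' + ((1 - t : ℝ) : EReal) * R x

/-- The standing assumptions on the equation `F(x) = y`. The operator `F` has domain `domF`, and
the operators `L x` are only meaningful for `x` in the closed ball `B_{2ρ}(x₀)`; the values of
`F` outside `domF` and of `L` outside the ball are irrelevant. -/
structure ForwardOperator (R : X → EReal) (σ : ℝ) (domF : Set X) (F : X → Y) (y : Y)
    (L : X → X →L[ℝ] Y) (x₀ ξ₀ : X) (ρ η Lmax : ℝ) : Prop where
  rho_pos : 0 < ρ
  subgradient : ξ₀ ∈ subdifferential R x₀
  ball_subset : closedBall x₀ (2 * ρ) ⊆ domF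
  exists_solution : ∃ x ∈ domF, F x = y ∧ bregman R ξ₀ x x₀ ≤ ((σ * ρ ^ 2 : ℝ) : EReal)
  weakly_closed : ∀ (u : ℕ → X) (x : X) (v : Y), (∀ n, u n ∈ domF) →
    Tendsto (fun n => toWeakSpace ℝ X (u n)) atTop (𝓝 (toWeakSpace ℝ X x)) →
    Tendsto (fun n => F (u n)) atTop (𝓝 v) → x ∈ domF ∧ F x = v
  continuousOn : ContinuousOn L (closedBall x₀ (2 * ρ))
  eta_nonneg : 0 ≤ η
  eta_lt_one : η < 1
  tangential_cone : ∀ x ∈ closedBall x₀ (2 * ρ), ∀ x' ∈ closedBall x₀ (2 * ρ),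
    ‖F x - F x' - L x' (x - x')‖ ≤ η * ‖F x - F x'‖
  Lmax_pos : 0 < Lmax
  norm_le : ∀ x ∈ closedBall x₀ (2 * ρ), ‖L x‖ ≤ Lmax

/-- `x` is a solution of `F(x) = y` that minimizes `D_R^{ξ₀}(·, x₀)` among all solutions. -/
def IsMinimalSolution (R : X → EReal) (domF : Set X) (F : X → Y) (y : Y) (x₀ ξ₀ x : X) : Prop :=
  x ∈ domF ∧ F x = y ∧ ∀ z ∈ domF, F z = y → bregman R ξ₀ x x₀ ≤ bregman R ξ₀ z x₀

/-- `x` minimizes `z ↦ R(z) - ⟨ξ, z⟩` over `X`. -/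
def IsMinimizer (R : X → EReal) (ξ x : X) : Prop :=
  ∀ z, R x - ((inner ℝ ξ x : ℝ) : EReal) ≤ R z - ((inner ℝ ξ z : ℝ) : EReal)

/-- `argmin_z {R(z) - ⟨ξ, z⟩}`. This is an arbitrary point if there is no minimizer, so that
using it in the iteration does not presuppose that minimizers exist. -/
def argmin (R : X → EReal) (ξ : X) : X :=
  Classical.epsilon (IsMinimizer R ξ)

/-- The residual `r_n = F(x_n) - y`. -/
def residual (F : X → Y) (y : Y) (x : ℕ → X) (n : ℕ) : Y := F (x n) - y

/-- `g_n = L(x_n)^* r_n`. -/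
def gradient (F : X → Y) (y : Y) (L : X → X →L[ℝ] Y) (x : ℕ → X) (n : ℕ) : X :=
  ContinuousLinearMap.adjoint (L (x n)) (residual F y x n)

/-- `m_n = ξ_n - ξ_{n-1}`, where `ξ_{-1} = ξ_0`. -/
def momentum (ξ : ℕ → X) : ℕ → X
  | 0 => 0
  | n + 1 => ξ (n + 1) - ξ n

open Classical in
/-- The adaptive heavy-ball iteration with exact data `y`. Here `α n` are the step sizes, `b n` the
momentum coefficients, `γ n` the auxiliary numbers entering `b n`; at each step `α n` is determined
by the constant rule or by the adaptive rule. -/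
structure Iteration (R : X → EReal) (F : X → Y) (y : Y) (L : X → X →L[ℝ] Y)
    (ξ₀ : X) (σ η Lmax μ₀ μ₁ β : ℝ) (ξ x : ℕ → X) (α b γ : ℕ → ℝ) : Prop where
  init : ξ 0 = ξ₀
  argmin_eq : ∀ n, x n = argmin R (ξ n)
  step_size : ∀ n, α n = μ₀ / Lmax ^ 2 ∨
    α n = if residual F y x n = 0 then 0 else
      min (μ₀ * ‖residual F y x n‖ ^ 2 / ‖gradient F y L x n‖ ^ 2) μ₁
  gamma_zero : γ 0 = 0
  gamma_succ : ∀ n, γ (n + 1) = inner ℝ (momentum ξ (n + 1)) (x (n + 1) - x n)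
    - (1 - η) * α n * ‖residual F y x n‖ ^ 2 + b n * γ n
  coeff : ∀ n, b n = if momentum ξ n = 0 then 0 else
    min (max 0 ((α n * inner ℝ (gradient F y L x n) (momentum ξ n) - 2 * σ * γ n)
      / ‖momentum ξ n‖ ^ 2)) β
  update : ∀ n, ξ (n + 1) = ξ n - α n • gradient F y L x n + b n • momentum ξ n

end AHB

end

/-! For a solution `z` write `D_n(z)` for the Bregman distance from `x_n` to `z` taken with `ξ_n`.
Strong convexity gives `D_{n+1}(z) ≤ D_n(z) + ⟨m_{n+1}, x_n - z⟩ + ‖m_{n+1}‖² / (4σ)`. The inner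
product involves the unknown `z`, but `γ` bounds `⟨m_n, x_n - z⟩` from above for every solution in
the ball at once (`Iteration.inner_momentum_le`). With that bound inserted, the right side is a
quadratic in the momentum coefficient, and the chosen coefficient does no worse than zero
(`Iteration.coeff_spec`). What is left is the decrease of a plain gradient step, a positive multiple
of `α_n ‖r_n‖²`. Hence `D_n(z)` decreases, the iterates stay in the ball, `α_n ‖r_n‖²` is summable
and the residuals tend to zero.

For the Cauchy property, compare `x_m` with a later `x_n` whose residual is a running minimum. The
identity `D_{ξ_m}(x_n, x_m) = D_m(p) - D_n(p) + ⟨ξ_n - ξ_m, x_n - p⟩` reduces everything to the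
momenta paired with `x_n - p`. The tangential cone condition and the momentum recursion bound these
pairings by a summable sequence independent of `n` (`Iteration.abs_inner_momentum_le`).

Under the kernel condition the difference of the limit and `x†` is orthogonal to every `ξ_n - ξ_0`.
So `ξ_0` may be replaced by `ξ_n` when their Bregman distances are compared, and `D_n` of the limit
tends to zero. -/

namespace AHB

/-! ### Strongly convex functionals and Bregman distances -/

section Convex

variable {X : Type*} [NormedAddCommGroup X] [InnerProductSpace ℝ X] {R : X → EReal} {σ : ℝ}

/-- The Bregman distance computed with the real values of `R`. -/
noncomputable def realBregman (R : X → EReal) (ξ z x : X) : ℝ :=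
  (R z).toReal - (R x).toReal - inner ℝ ξ (z - x)

theorem RegFunctional.coe_toReal (hR : RegFunctional R σ) {x : X} (hx : R x ≠ ⊤) :
    ((R x).toReal : EReal) = R x :=
  EReal.coe_toReal hx (hR.ne_bot x)

theorem RegFunctional.bregman_eq (hR : RegFunctional R σ) {x z : X} (hx : R x ≠ ⊤)
    (hz : R z ≠ ⊤) (ξ : X) : bregman R ξ z x = (realBregman R ξ z x : EReal) := by
  rw [bregman, ← hR.coe_toReal hx, ← hR.coe_toReal hz, realBregman]
  norm_cast

theorem RegFunctional.bregman_eq_top (hR : RegFunctional R σ) {x z : X} (hx : R x ≠ ⊤)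
    (hz : R z = ⊤) (ξ : X) : bregman R ξ z x = ⊤ := by
  rw [bregman, ← hR.coe_toReal hx, hz, EReal.top_sub_coe, EReal.top_sub_coe]

theorem RegFunctional.ne_top_of_bregman_le (hR : RegFunctional R σ) {x z ξ : X} {c : ℝ}
    (hx : R x ≠ ⊤) (h : bregman R ξ z x ≤ (c : EReal)) : R z ≠ ⊤ := by
  intro hz
  rw [hR.bregman_eq_top hx hz, top_le_iff] at h
  exact EReal.coe_ne_top _ h

theorem RegFunctional.strongly_convex_toReal (hR : RegFunctional R σ) {a b : X} (ha : R a ≠ ⊤)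
    (hb : R b ≠ ⊤) {t : ℝ} (ht₀ : 0 ≤ t) (ht₁ : t ≤ 1) :
    R (t • a + (1 - t) • b) ≠ ⊤ ∧
      (R (t • a + (1 - t) • b)).toReal + σ * t * (1 - t) * ‖a - b‖ ^ 2
        ≤ t * (R a).toReal + (1 - t) * (R b).toReal := by
  have h := hR.strongly_convex a b ha hb t ht₀ ht₁
  rw [← hR.coe_toReal ha, ← hR.coe_toReal hb, ← EReal.coe_mul, ← EReal.coe_mul,
    ← EReal.coe_add] at h
  have hne : R (t • a + (1 - t) • b) ≠ ⊤ := by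
    intro htop
    rw [htop, EReal.top_add_coe, top_le_iff] at h
    exact EReal.coe_ne_top _ h
  refine ⟨hne, ?_⟩
  rw [← hR.coe_toReal hne, ← EReal.coe_add, EReal.coe_le_coe_iff] at h
  exact h

theorem RegFunctional.ne_top_of_mem_subdifferential (hR : RegFunctional R σ) {x ξ : X}
    (h : ξ ∈ subdifferential R x) : R x ≠ ⊤ := by
  intro hx
  obtain ⟨z, hz⟩ := hR.proper
  have := h z
  rw [hx, EReal.top_add_coe, top_le_iff] at this
  exact hz this

theorem RegFunctional.norm_sq_le_realBregman (hR : RegFunctional R σ) {x ξ z : X}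
    (h : ξ ∈ subdifferential R x) (hz : R z ≠ ⊤) :
    σ * ‖z - x‖ ^ 2 ≤ realBregman R ξ z x := by
  have hx := hR.ne_top_of_mem_subdifferential h
  have hK : 0 ≤ σ * ‖z - x‖ ^ 2 := mul_nonneg hR.sigma_pos.le (sq_nonneg _)
  have key : ∀ t : ℝ, 0 < t → t ≤ 1 → (1 - t) * (σ * ‖z - x‖ ^ 2) ≤ realBregman R ξ z x := by
    intro t ht₀ ht₁
    obtain ⟨hp, hle⟩ := hR.strongly_convex_toReal hz hx ht₀.le ht₁
    have hsub := h (t • z + (1 - t) • x)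
    rw [← hR.coe_toReal hp, ← hR.coe_toReal hx, ← EReal.coe_add, EReal.coe_le_coe_iff,
      show t • z + (1 - t) • x - x = t • (z - x) by module, inner_smul_right] at hsub
    have : t * ((1 - t) * (σ * ‖z - x‖ ^ 2)) ≤ t * realBregman R ξ z x := by
      rw [realBregman]; linarith
    exact le_of_mul_le_mul_left this ht₀
  refine le_of_forall_pos_le_add fun ε hε => ?_
  -- Stands for `t → 0` in `key`; the `+ 1` keeps the denominator positive when `z = x`.
  have ht : 0 < min 1 (ε / (σ * ‖z - x‖ ^ 2 + 1)) := by positivity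
  have h1 := key _ ht (min_le_left _ _)
  have h2 : min 1 (ε / (σ * ‖z - x‖ ^ 2 + 1)) * (σ * ‖z - x‖ ^ 2 + 1) ≤ ε := by
    rw [← le_div_iff₀ (by positivity)]
    exact min_le_right _ _
  linarith

theorem RegFunctional.realBregman_nonneg (hR : RegFunctional R σ) {x ξ z : X}
    (h : ξ ∈ subdifferential R x) (hz : R z ≠ ⊤) : 0 ≤ realBregman R ξ z x :=
  (mul_nonneg hR.sigma_pos.le (sq_nonneg _)).trans (hR.norm_sq_le_realBregman h hz)

/-- Real upper bounds on `R` pass to the limit. -/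
theorem RegFunctional.le_of_tendsto (hR : RegFunctional R σ) {ι : Type*} {l : Filter ι} [l.NeBot]
    {u : ι → X} {x : X} {a : ι → ℝ} {c : ℝ} (hu : Tendsto u l (𝓝 x)) (ha : Tendsto a l (𝓝 c))
    (h : ∀ᶠ i in l, R (u i) ≤ (a i : EReal)) : R x ≤ (c : EReal) := by
  by_contra! hlt
  obtain ⟨d, hcd, hdx⟩ := EReal.lt_iff_exists_real_btwn.1 hlt
  have h1 := hu.eventually (hR.lsc x d hdx)
  have h2 := ha.eventually (gt_mem_nhds (EReal.coe_lt_coe_iff.1 hcd))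
  obtain ⟨i, hi, hi1, hi2⟩ := (h.and (h1.and h2)).exists
  have := hi1.trans_le hi
  rw [EReal.coe_lt_coe_iff] at this
  exact lt_asymm this hi2

/-- Completing the square. The `4 * σ` here is the one in the condition on `μ₀`. -/
theorem inner_sub_le_norm_sq_div (hσ : 0 < σ) (m d : X) :
    inner ℝ m d - σ * ‖d‖ ^ 2 ≤ ‖m‖ ^ 2 / (4 * σ) := by
  rw [le_div_iff₀ (by positivity)]
  have h := real_inner_le_norm m d
  nlinarith [sq_nonneg (‖m‖ - 2 * σ * ‖d‖)]

/-- A strongly convex functional attains its minimum, up to a linear perturbation, on closed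
convex sets. -/
theorem RegFunctional.exists_min [CompleteSpace X] (hR : RegFunctional R σ) {x₀ ξ₀ : X}
    (h₀ : ξ₀ ∈ subdifferential R x₀) (ξ : X) {C : Set X} (hC : IsClosed C) (hC' : Convex ℝ C)
    {w : X} (hw : w ∈ C) (hwR : R w ≠ ⊤) :
    ∃ x ∈ C, R x ≠ ⊤ ∧ ∀ z ∈ C, R z ≠ ⊤ →
      (R x).toReal - inner ℝ ξ x ≤ (R z).toReal - inner ℝ ξ z := by
  set h : X → ℝ := fun z => (R z).toReal - inner ℝ ξ z with hdef
  set S : Set ℝ := h '' {z | z ∈ C ∧ R z ≠ ⊤} with hS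
  have hne : S.Nonempty := ⟨h w, w, ⟨hw, hwR⟩, rfl⟩
  have hbdd : BddBelow S := by
    refine ⟨(R x₀).toReal - inner ℝ ξ x₀ - ‖ξ - ξ₀‖ ^ 2 / (4 * σ), ?_⟩
    rintro _ ⟨z, ⟨-, hz⟩, rfl⟩
    have h1 := hR.norm_sq_le_realBregman h₀ hz
    have h2 := inner_sub_le_norm_sq_div hR.sigma_pos (ξ - ξ₀) (z - x₀)
    rw [inner_sub_left, inner_sub_right ξ] at h2
    simp only [hdef, realBregman] at h1 ⊢
    linarith
  set m := sInf S with hm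
  have hlow : ∀ z ∈ C, R z ≠ ⊤ → m ≤ h z := fun z hz hz' => csInf_le hbdd ⟨z, ⟨hz, hz'⟩, rfl⟩
  have hex : ∀ n : ℕ, ∃ z, (z ∈ C ∧ R z ≠ ⊤) ∧ h z < m + 1 / ((n : ℝ) + 1) := by
    intro n
    obtain ⟨_, ⟨z, hz, rfl⟩, hlt⟩ := exists_lt_of_csInf_lt hne
      (lt_add_of_pos_right m (Nat.one_div_pos_of_nat (n := n) (α := ℝ)))
    exact ⟨z, hz, hlt⟩
  choose u hu hum using hex
  -- Strong convexity at the midpoint, which lies in `C` and so has value at least `m`; this makes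
  -- the minimizing sequence Cauchy.
  have hmid : ∀ i j, σ / 4 * ‖u i - u j‖ ^ 2 ≤ (h (u i) + h (u j)) / 2 - m := by
    intro i j
    obtain ⟨h1, h2⟩ := hR.strongly_convex_toReal (hu i).2 (hu j).2 (t := 1 / 2)
      (by norm_num) (by norm_num)
    have h3 := hlow _ (hC' (hu i).1 (hu j).1 (a := 1 / 2) (b := 1 - 1 / 2) (by norm_num)
      (by norm_num) (by norm_num)) h1
    simp only [hdef, inner_add_right, inner_smul_right] at h3 ⊢
    linarith
  have hcau : CauchySeq u := by
    rw [Metric.cauchySeq_iff']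
    intro ε hε
    obtain ⟨N, hN⟩ := exists_nat_one_div_lt (show 0 < σ / 4 * ε ^ 2 by
      have := hR.sigma_pos; positivity)
    refine ⟨N, fun n hn => ?_⟩
    have h1 := hmid n N
    have h2 : 1 / ((n : ℝ) + 1) ≤ 1 / ((N : ℝ) + 1) := Nat.one_div_le_one_div hn
    have h3 := hum n
    have h4 := hum N
    have h5 : σ / 4 * ‖u n - u N‖ ^ 2 < σ / 4 * ε ^ 2 := by linarith
    rw [dist_eq_norm]
    exact lt_of_pow_lt_pow_left₀ 2 hε.le
      (lt_of_mul_lt_mul_left h5 (by have := hR.sigma_pos; positivity))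
  obtain ⟨x, hx⟩ := cauchySeq_tendsto_of_complete hcau
  have hRx : R x ≤ ((m + 0 + inner ℝ ξ x : ℝ) : EReal) := by
    refine hR.le_of_tendsto hx
      (((tendsto_const_nhds (x := m)).add tendsto_one_div_add_atTop_nhds_zero_nat).add
        (tendsto_const_nhds.inner hx)) (Eventually.of_forall fun n => ?_)
    rw [← hR.coe_toReal (hu n).2, EReal.coe_le_coe_iff]
    have := hum n
    simp only [hdef] at this
    linarith
  have hxtop : R x ≠ ⊤ := fun htop => by
    rw [htop, top_le_iff] at hRx
    exact EReal.coe_ne_top _ hRx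
  refine ⟨x, hC.mem_of_tendsto hx (Eventually.of_forall fun n => (hu n).1), hxtop,
    fun z hz hz' => ?_⟩
  rw [← hR.coe_toReal hxtop, EReal.coe_le_coe_iff] at hRx
  have := hlow z hz hz'
  simp only [hdef] at this
  linarith

theorem RegFunctional.eq_of_min (hR : RegFunctional R σ) (ξ : X) {C : Set X} (hC' : Convex ℝ C)
    {x x' : X} (hx : x ∈ C) (hxR : R x ≠ ⊤) (hx' : x' ∈ C) (hxR' : R x' ≠ ⊤)
    (h : ∀ z ∈ C, R z ≠ ⊤ → (R x).toReal - inner ℝ ξ x ≤ (R z).toReal - inner ℝ ξ z)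
    (h' : (R x').toReal - inner ℝ ξ x' ≤ (R x).toReal - inner ℝ ξ x) : x' = x := by
  obtain ⟨h1, h2⟩ := hR.strongly_convex_toReal hxR' hxR (t := 1 / 2) (by norm_num) (by norm_num)
  have h3 := h _ (hC' hx' hx (a := 1 / 2) (b := 1 - 1 / 2) (by norm_num) (by norm_num)
    (by norm_num)) h1
  rw [inner_add_right, inner_smul_right, inner_smul_right] at h3
  have h5 : σ * ‖x' - x‖ ^ 2 ≤ σ * 0 := by linarith
  have h6 := le_of_mul_le_mul_left h5 hR.sigma_pos
  have h7 : ‖x' - x‖ = 0 := by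
    have := sq_nonneg ‖x' - x‖
    exact pow_eq_zero_iff two_ne_zero |>.1 (le_antisymm h6 this)
  exact sub_eq_zero.1 (norm_eq_zero.1 h7)

theorem RegFunctional.isMinimizer_iff (hR : RegFunctional R σ) {ξ x : X} :
    IsMinimizer R ξ x ↔ R x ≠ ⊤ ∧
      ∀ z, R z ≠ ⊤ → (R x).toReal - inner ℝ ξ x ≤ (R z).toReal - inner ℝ ξ z := by
  constructor
  · intro h
    have hx : R x ≠ ⊤ := by
      intro hx
      obtain ⟨z, hz⟩ := hR.proper
      have := h z
      rw [hx, EReal.top_sub_coe, ← hR.coe_toReal hz, ← EReal.coe_sub, top_le_iff] at this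
      exact EReal.coe_ne_top _ this
    refine ⟨hx, fun z hz => ?_⟩
    have := h z
    rwa [← hR.coe_toReal hz, ← hR.coe_toReal hx, ← EReal.coe_sub, ← EReal.coe_sub,
      EReal.coe_le_coe_iff] at this
  · rintro ⟨hx, h⟩ z
    by_cases hz : R z = ⊤
    · rw [hz, EReal.top_sub_coe]
      exact le_top
    · rw [← hR.coe_toReal hz, ← hR.coe_toReal hx, ← EReal.coe_sub, ← EReal.coe_sub,
        EReal.coe_le_coe_iff]
      exact h z hz

theorem RegFunctional.isMinimizer_iff_mem_subdifferential (hR : RegFunctional R σ) {ξ x : X} :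
    IsMinimizer R ξ x ↔ ξ ∈ subdifferential R x := by
  rw [hR.isMinimizer_iff]
  constructor
  · rintro ⟨hx, h⟩ z
    by_cases hz : R z = ⊤
    · rw [hz]
      exact le_top
    · rw [← hR.coe_toReal hz, ← hR.coe_toReal hx, ← EReal.coe_add, EReal.coe_le_coe_iff,
        inner_sub_right]
      linarith [h z hz]
  · intro h
    have hx := hR.ne_top_of_mem_subdifferential h
    refine ⟨hx, fun z hz => ?_⟩
    have := h z
    rw [← hR.coe_toReal hz, ← hR.coe_toReal hx, ← EReal.coe_add, EReal.coe_le_coe_iff,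
        inner_sub_right] at this
    linarith

theorem RegFunctional.existsUnique_isMinimizer [CompleteSpace X] (hR : RegFunctional R σ)
    {x₀ ξ₀ : X} (h₀ : ξ₀ ∈ subdifferential R x₀) (ξ : X) : ∃! z, IsMinimizer R ξ z := by
  obtain ⟨x, -, hx, hmin⟩ := hR.exists_min h₀ ξ isClosed_univ convex_univ (Set.mem_univ x₀)
    (hR.ne_top_of_mem_subdifferential h₀)
  refine ⟨x, hR.isMinimizer_iff.2 ⟨hx, fun z hz => hmin z (Set.mem_univ z) hz⟩, fun x' hx' => ?_⟩
  obtain ⟨hx'R, hx'min⟩ := hR.isMinimizer_iff.1 hx'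
  exact hR.eq_of_min ξ convex_univ (Set.mem_univ x) hx (Set.mem_univ x') hx'R hmin (hx'min x hx)

/-- One step of the dual iteration changes the Bregman distance to a fixed point in a controlled
way. -/
theorem RegFunctional.realBregman_succ_le (hR : RegFunctional R σ) {x x' ξ ξ' : X} (z : X)
    (h : ξ ∈ subdifferential R x) (h' : ξ' ∈ subdifferential R x') :
    realBregman R ξ' z x' ≤ realBregman R ξ z x + inner ℝ (ξ' - ξ) (x - z)
      + ‖ξ' - ξ‖ ^ 2 / (4 * σ) := by
  -- Exactly, the Bregman distance changes by `⟨ξ' - ξ, x - z⟩ + ⟨ξ' - ξ, x' - x⟩ - D_ξ(x', x)`.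
  -- Strong convexity bounds the last term by `-σ‖x' - x‖²`, which absorbs the middle one.
  have h1 := hR.norm_sq_le_realBregman h (hR.ne_top_of_mem_subdifferential h')
  have h2 := inner_sub_le_norm_sq_div hR.sigma_pos (ξ' - ξ) (x' - x)
  simp only [realBregman, inner_sub_left, inner_sub_right] at h1 h2 ⊢
  linarith

end Convex

/-- The linear recursion `A (n + 1) = β A n + a n` preserves summability when `β < 1`. -/
theorem exists_summable_recursion {β : ℝ} (hβ : 0 ≤ β) (hβ' : β < 1) {a : ℕ → ℝ}
    (ha : ∀ n, 0 ≤ a n) (hs : Summable a) :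
    ∃ A : ℕ → ℝ, A 0 = 0 ∧ (∀ n, A (n + 1) = β * A n + a n) ∧ Summable A := by
  let A : ℕ → ℝ := fun n => Nat.rec 0 (fun k v => β * v + a k) n
  have hsucc : ∀ n, A (n + 1) = β * A n + a n := fun n => rfl
  have hnn : ∀ n, 0 ≤ A n := by
    intro n
    induction n with
    | zero => exact le_rfl
    | succ k ih => rw [hsucc]; exact add_nonneg (mul_nonneg hβ ih) (ha k)
  refine ⟨A, rfl, hsucc, ?_⟩
  refine summable_of_sum_range_le (c := (∑' n, a n) / (1 - β)) hnn fun n => ?_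
  -- Since `A 0 = 0`, the shifted sum satisfies the same recursion, so `(1 - β) ∑ A ≤ ∑ a`.
  have h1 : ∑ i ∈ Finset.range (n + 1), A i
      = β * ∑ i ∈ Finset.range n, A i + ∑ i ∈ Finset.range n, a i := by
    rw [Finset.sum_range_succ', Finset.mul_sum, ← Finset.sum_add_distrib]
    simp only [hsucc]
    exact add_zero _
  rw [Finset.sum_range_succ] at h1
  have h2 := hs.sum_le_tsum (Finset.range n) fun i _ => ha i
  rw [le_div_iff₀ (by linarith)]
  linarith [hnn n]

/-! ### The tangential cone condition and the set of solutions -/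

section Main

variable {X Y : Type*} [NormedAddCommGroup X] [InnerProductSpace ℝ X]
  [NormedAddCommGroup Y] [InnerProductSpace ℝ Y]
  {R : X → EReal} {σ : ℝ} {domF : Set X} {F : X → Y} {y : Y} {L : X → X →L[ℝ] Y} {x₀ ξ₀ : X}
  {ρ η Lmax : ℝ}

/-- Within the ball, the solutions form an affine set directed by the kernel of `L`. -/
theorem ForwardOperator.solution_iff (hF : ForwardOperator R σ domF F y L x₀ ξ₀ ρ η Lmax)
    {p z : X} (hp : p ∈ closedBall x₀ (2 * ρ)) (hz : z ∈ closedBall x₀ (2 * ρ)) (hFp : F p = y) :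
    F z = y ↔ L p (z - p) = 0 := by
  have h := hF.tangential_cone z hz p hp
  constructor
  · intro hFz
    rw [hFz, hFp, sub_self, zero_sub, norm_neg, norm_zero, mul_zero] at h
    exact norm_le_zero_iff.1 h
  · intro hL
    rw [hL, sub_zero, hFp] at h
    have h1 : ‖F z - y‖ ≤ 0 := by nlinarith [hF.eta_lt_one, norm_nonneg (F z - y)]
    exact sub_eq_zero.1 (norm_le_zero_iff.1 h1)

theorem ForwardOperator.norm_apply_le (hF : ForwardOperator R σ domF F y L x₀ ξ₀ ρ η Lmax)
    {p z : X} (hp : p ∈ closedBall x₀ (2 * ρ)) (hz : z ∈ closedBall x₀ (2 * ρ)) :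
    ‖L p (z - p)‖ ≤ (1 + η) * ‖F z - F p‖ := by
  have h := hF.tangential_cone z hz p hp
  have h1 := norm_sub_norm_le (L p (z - p)) (F z - F p)
  rw [norm_sub_rev (L p (z - p))] at h1
  linarith

/-- The cone condition says that `L p (p - z)` differs from the residual `F p - y` by at most `η`
times its norm; Cauchy–Schwarz does the rest. -/
theorem ForwardOperator.inner_residual_ge (hF : ForwardOperator R σ domF F y L x₀ ξ₀ ρ η Lmax)
    {p z : X} (hp : p ∈ closedBall x₀ (2 * ρ)) (hz : z ∈ closedBall x₀ (2 * ρ)) (hFz : F z = y) :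
    (1 - η) * ‖F p - y‖ ^ 2 ≤ inner ℝ (F p - y) (L p (p - z)) := by
  have h := hF.tangential_cone z hz p hp
  rw [hFz, norm_sub_rev y, show y - F p - L p (z - p) = L p (p - z) - (F p - y) by
    rw [← neg_sub p z, map_neg]; abel] at h
  have h1 := neg_le_of_abs_le (abs_real_inner_le_norm (F p - y) (L p (p - z) - (F p - y)))
  rw [inner_sub_right, real_inner_self_eq_norm_sq] at h1
  nlinarith [mul_le_mul_of_nonneg_left h (norm_nonneg (F p - y))]

theorem ForwardOperator.mem_closedBall_of_le (hR : RegFunctional R σ)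
    (hF : ForwardOperator R σ domF F y L x₀ ξ₀ ρ η Lmax) {z : X} (hz : R z ≠ ⊤)
    (h : realBregman R ξ₀ z x₀ ≤ σ * ρ ^ 2) : z ∈ closedBall x₀ ρ := by
  have h1 := (hR.norm_sq_le_realBregman hF.subgradient hz).trans h
  have h2 := le_of_mul_le_mul_left h1 hR.sigma_pos
  rw [mem_closedBall, dist_eq_norm]
  exact le_of_sq_le_sq h2 hF.rho_pos.le

theorem ForwardOperator.exists_solution_real (hR : RegFunctional R σ)
    (hF : ForwardOperator R σ domF F y L x₀ ξ₀ ρ η Lmax) :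
    ∃ p ∈ domF, F p = y ∧ R p ≠ ⊤ ∧ realBregman R ξ₀ p x₀ ≤ σ * ρ ^ 2 ∧
      p ∈ closedBall x₀ ρ := by
  obtain ⟨p, hp, hFp, hle⟩ := hF.exists_solution
  have hx₀ := hR.ne_top_of_mem_subdifferential hF.subgradient
  have hpR := hR.ne_top_of_bregman_le hx₀ hle
  rw [hR.bregman_eq hx₀ hpR, EReal.coe_le_coe_iff] at hle
  exact ⟨p, hp, hFp, hpR, hle, hF.mem_closedBall_of_le hR hpR hle⟩

theorem ForwardOperator.closedBall_subset_two
    (hF : ForwardOperator R σ domF F y L x₀ ξ₀ ρ η Lmax) :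
    closedBall x₀ ρ ⊆ closedBall x₀ (2 * ρ) :=
  closedBall_subset_closedBall (by linarith [hF.rho_pos])

/-- Some solution has Bregman distance at most `σ * ρ ^ 2`, so any competitor outside the ball of
radius `ρ` loses to it. This localizes the problem to where the cone condition holds. -/
theorem ForwardOperator.isMinimalSolution_iff (hR : RegFunctional R σ)
    (hF : ForwardOperator R σ domF F y L x₀ ξ₀ ρ η Lmax) {x : X} :
    IsMinimalSolution R domF F y x₀ ξ₀ x ↔
      (x ∈ closedBall x₀ ρ ∧ F x = y) ∧ R x ≠ ⊤ ∧ ∀ z ∈ closedBall x₀ ρ ∩ {z | F z = y},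
        R z ≠ ⊤ → (R x).toReal - inner ℝ ξ₀ x ≤ (R z).toReal - inner ℝ ξ₀ z := by
  have hx₀ := hR.ne_top_of_mem_subdifferential hF.subgradient
  obtain ⟨p, hpdom, hFp, hpR, hple, hpball⟩ := hF.exists_solution_real hR
  constructor
  · rintro ⟨hxdom, hFx, hmin⟩
    have h1 := hmin p hpdom hFp
    rw [hR.bregman_eq hx₀ hpR] at h1
    have hxR := hR.ne_top_of_bregman_le hx₀ h1
    rw [hR.bregman_eq hx₀ hxR, EReal.coe_le_coe_iff] at h1
    refine ⟨⟨hF.mem_closedBall_of_le hR hxR (h1.trans hple), hFx⟩, hxR, fun z hz hzR => ?_⟩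
    have h2 := hmin z (hF.ball_subset (hF.closedBall_subset_two hz.1)) hz.2
    rw [hR.bregman_eq hx₀ hzR, hR.bregman_eq hx₀ hxR, EReal.coe_le_coe_iff, realBregman,
      realBregman, inner_sub_right, inner_sub_right] at h2
    linarith
  · rintro ⟨⟨hxball, hFx⟩, hxR, hmin⟩
    refine ⟨hF.ball_subset (hF.closedBall_subset_two hxball), hFx, fun z _ hFz => ?_⟩
    by_cases hzR : R z = ⊤
    · rw [hR.bregman_eq_top hx₀ hzR]
      exact le_top
    rw [hR.bregman_eq hx₀ hzR, hR.bregman_eq hx₀ hxR, EReal.coe_le_coe_iff]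
    have h1 := hmin p ⟨hpball, hFp⟩ hpR
    by_cases hz : realBregman R ξ₀ z x₀ ≤ σ * ρ ^ 2
    · have h2 := hmin z ⟨hF.mem_closedBall_of_le hR hzR hz, hFz⟩ hzR
      simp only [realBregman, inner_sub_right]
      linarith
    · simp only [realBregman, inner_sub_right] at hz hple ⊢
      linarith

variable [CompleteSpace X]

/-- Although `F` is nonlinear, its solutions in the small ball are the slice of that ball by a
translate of the kernel of `L p`, hence a closed convex set. -/
theorem ForwardOperator.existsUnique_isMinimalSolution (hR : RegFunctional R σ)
    (hF : ForwardOperator R σ domF F y L x₀ ξ₀ ρ η Lmax) :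
    ∃! x, IsMinimalSolution R domF F y x₀ ξ₀ x := by
  obtain ⟨p, hpdom, hFp, hpR, hple, hpball⟩ := hF.exists_solution_real hR
  have hsub := hF.closedBall_subset_two
  have hset : closedBall x₀ ρ ∩ {z | F z = y} = closedBall x₀ ρ ∩ {z | L p z = L p p} := by
    ext z
    refine and_congr_right fun hz => ?_
    rw [Set.mem_ofPred_eq, Set.mem_ofPred_eq, hF.solution_iff (hsub hpball) (hsub hz) hFp, map_sub,
      sub_eq_zero]
  have hclosed : IsClosed (closedBall x₀ ρ ∩ {z | F z = y}) := by
    rw [hset]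
    exact isClosed_closedBall.inter (isClosed_eq (L p).continuous continuous_const)
  have hconv : Convex ℝ (closedBall x₀ ρ ∩ {z | F z = y}) := by
    rw [hset]
    refine (convex_closedBall _ _).inter fun a ha b hb s t _ _ hst => ?_
    simp only [Set.mem_ofPred_eq] at ha hb ⊢
    rw [map_add, map_smul, map_smul, ha, hb, ← add_smul, hst, one_smul]
  obtain ⟨x, hx, hxR, hmin⟩ := hR.exists_min hF.subgradient ξ₀ hclosed hconv ⟨hpball, hFp⟩ hpR
  refine ⟨x, (hF.isMinimalSolution_iff hR).2 ⟨hx, hxR, hmin⟩, fun x' hx' => ?_⟩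
  obtain ⟨hx'1, hx'R, hx'min⟩ := (hF.isMinimalSolution_iff hR).1 hx'
  exact hR.eq_of_min ξ₀ hconv hx hxR hx'1 hx'R hmin (hx'min x hx hxR)

/-! ### One step of the iteration: step sizes, momentum and descent -/

variable [CompleteSpace Y] {μ₀ μ₁ β : ℝ} {ξ x : ℕ → X} {α b γ : ℕ → ℝ}

theorem Iteration.isMinimizer (hR : RegFunctional R σ)
    (hF : ForwardOperator R σ domF F y L x₀ ξ₀ ρ η Lmax)
    (hx : Iteration R F y L ξ₀ σ η Lmax μ₀ μ₁ β ξ x α b γ) (n : ℕ) :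
    IsMinimizer R (ξ n) (x n) := by
  rw [hx.argmin_eq n]
  exact Classical.epsilon_spec (hR.existsUnique_isMinimizer hF.subgradient (ξ n)).exists

theorem Iteration.mem_subdifferential (hR : RegFunctional R σ)
    (hF : ForwardOperator R σ domF F y L x₀ ξ₀ ρ η Lmax)
    (hx : Iteration R F y L ξ₀ σ η Lmax μ₀ μ₁ β ξ x α b γ) (n : ℕ) :
    ξ n ∈ subdifferential R (x n) :=
  hR.isMinimizer_iff_mem_subdifferential.1 (hx.isMinimizer hR hF n)

theorem Iteration.x_zero (hR : RegFunctional R σ)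
    (hF : ForwardOperator R σ domF F y L x₀ ξ₀ ρ η Lmax)
    (hx : Iteration R F y L ξ₀ σ η Lmax μ₀ μ₁ β ξ x α b γ) : x 0 = x₀ :=
  (hR.existsUnique_isMinimizer hF.subgradient ξ₀).unique (hx.init ▸ hx.isMinimizer hR hF 0)
    (hR.isMinimizer_iff_mem_subdifferential.2 hF.subgradient)

theorem Iteration.momentum_succ (hx : Iteration R F y L ξ₀ σ η Lmax μ₀ μ₁ β ξ x α b γ) (n : ℕ) :
    momentum ξ (n + 1) = b n • momentum ξ n - α n • gradient F y L x n := by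
  rw [show momentum ξ (n + 1) = ξ (n + 1) - ξ n from rfl, hx.update n]
  abel

theorem inner_gradient (n : ℕ) (v : X) :
    inner ℝ (gradient F y L x n) v = inner ℝ (residual F y x n) (L (x n) v) :=
  ContinuousLinearMap.adjoint_inner_left _ _ _

theorem ForwardOperator.norm_gradient_le (hF : ForwardOperator R σ domF F y L x₀ ξ₀ ρ η Lmax)
    {n : ℕ} (hn : x n ∈ closedBall x₀ (2 * ρ)) :
    ‖gradient F y L x n‖ ≤ Lmax * ‖residual F y x n‖ := by
  refine (ContinuousLinearMap.le_opNorm _ _).trans ?_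
  rw [LinearIsometryEquiv.norm_map]
  exact mul_le_mul_of_nonneg_right (hF.norm_le _ hn) (norm_nonneg _)

theorem Iteration.step_nonneg (hμ₀ : 0 < μ₀) (hμ₁ : 0 < μ₁)
    (hx : Iteration R F y L ξ₀ σ η Lmax μ₀ μ₁ β ξ x α b γ) (n : ℕ) : 0 ≤ α n := by
  rcases hx.step_size n with h | h
  · rw [h]; positivity
  · rw [h]; split_ifs <;> positivity

theorem Iteration.step_mul_norm_gradient_le (hμ₀ : 0 < μ₀)
    (hF : ForwardOperator R σ domF F y L x₀ ξ₀ ρ η Lmax)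
    (hx : Iteration R F y L ξ₀ σ η Lmax μ₀ μ₁ β ξ x α b γ) {n : ℕ}
    (hn : x n ∈ closedBall x₀ (2 * ρ)) :
    α n * ‖gradient F y L x n‖ ^ 2 ≤ μ₀ * ‖residual F y x n‖ ^ 2 := by
  have hL := hF.Lmax_pos
  rcases hx.step_size n with h | h
  · rw [h, div_mul_eq_mul_div, div_le_iff₀ (by positivity), mul_assoc, ← mul_pow]
    gcongr
    rw [mul_comm]
    exact hF.norm_gradient_le hn
  · by_cases hr : residual F y x n = 0
    · rw [h, if_pos hr, zero_mul]; positivity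
    rw [if_neg hr] at h
    -- Division by zero makes the adaptive quotient `0` here, which is harmless because the gradient
    -- also vanishes on the left.
    by_cases hg : gradient F y L x n = 0
    · rw [hg, norm_zero]
      simp only [ne_eq, OfNat.ofNat_ne_zero, not_false_eq_true, zero_pow, mul_zero]
      positivity
    · have hg' : 0 < ‖gradient F y L x n‖ := norm_pos_iff.2 hg
      rw [← le_div_iff₀ (by positivity), h]
      exact min_le_left _ _

/-- Step sizes are bounded below unless the residual vanishes. The factor `‖residual F y x n‖ ^ 2`
covers that case, where the adaptive rule gives `0`. -/
theorem Iteration.norm_residual_le (hR : RegFunctional R σ) (hμ₀ : 0 < μ₀)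
    (hF : ForwardOperator R σ domF F y L x₀ ξ₀ ρ η Lmax)
    (hx : Iteration R F y L ξ₀ σ η Lmax μ₀ μ₁ β ξ x α b γ) {n : ℕ}
    (hn : x n ∈ closedBall x₀ (2 * ρ)) :
    min (μ₀ / Lmax ^ 2) μ₁ * ‖residual F y x n‖ ^ 2 ≤ α n * ‖residual F y x n‖ ^ 2 := by
  have hL := hF.Lmax_pos
  by_cases hr : residual F y x n = 0
  · rw [hr, norm_zero]; simp
  refine mul_le_mul_of_nonneg_right ?_ (sq_nonneg _)
  rcases hx.step_size n with h | h
  · rw [h]; exact min_le_left _ _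
  rw [if_neg hr] at h
  have hr' : 0 < ‖residual F y x n‖ := norm_pos_iff.2 hr
  -- A vanishing gradient with nonzero residual would force the step to `0`; pairing the gradient
  -- with `x n - p` for a solution `p` rules it out.
  have hg : gradient F y L x n ≠ 0 := by
    intro hg
    obtain ⟨p, -, hFp, -, -, hp⟩ := hF.exists_solution_real hR
    have h1 := hF.inner_residual_ge hn (hF.closedBall_subset_two hp) hFp
    have h2 := inner_gradient (F := F) (y := y) (L := L) (x := x) n (x n - p)
    rw [hg, inner_zero_left] at h2
    change (1 - η) * ‖residual F y x n‖ ^ 2 ≤ inner ℝ (residual F y x n) (L (x n) (x n - p)) at h1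
    rw [← h2] at h1
    have := hF.eta_lt_one
    have : 0 < (1 - η) * ‖residual F y x n‖ ^ 2 := mul_pos (by linarith) (by positivity)
    linarith
  have hg' : 0 < ‖gradient F y L x n‖ := norm_pos_iff.2 hg
  rw [h]
  refine min_le_min_right _ ?_
  rw [div_le_div_iff₀ (by positivity) (by positivity), mul_assoc, ← mul_pow]
  gcongr
  rw [mul_comm]
  exact hF.norm_gradient_le hn

theorem Iteration.coeff_nonneg (hβ : 0 < β)
    (hx : Iteration R F y L ξ₀ σ η Lmax μ₀ μ₁ β ξ x α b γ) (n : ℕ) : 0 ≤ b n := by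
  rw [hx.coeff n]; split_ifs <;> positivity

theorem Iteration.coeff_le (hβ : 0 < β)
    (hx : Iteration R F y L ξ₀ σ η Lmax μ₀ μ₁ β ξ x α b γ) (n : ℕ) : b n ≤ β := by
  rw [hx.coeff n]
  split_ifs
  · exact hβ.le
  · exact min_le_right _ _

/-- The choice of the momentum coefficient never increases the upper bound it minimizes. -/
theorem Iteration.coeff_spec (hβ : 0 < β)
    (hx : Iteration R F y L ξ₀ σ η Lmax μ₀ μ₁ β ξ x α b γ) (n : ℕ) :
    b n ^ 2 * ‖momentum ξ n‖ ^ 2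
      ≤ 2 * b n * (α n * inner ℝ (gradient F y L x n) (momentum ξ n) - 2 * σ * γ n) := by
  have hb := hx.coeff n
  by_cases hm : momentum ξ n = 0
  · rw [if_pos hm] at hb
    rw [hb]; simp
  rw [if_neg hm] at hb
  have hm' : 0 < ‖momentum ξ n‖ := norm_pos_iff.2 hm
  set q := α n * inner ℝ (gradient F y L x n) (momentum ξ n) - 2 * σ * γ n
  have h0 := hx.coeff_nonneg hβ n
  rcases le_or_gt q 0 with hq | hq
  · rw [max_eq_left (div_nonpos_of_nonpos_of_nonneg hq (by positivity)), min_eq_left hβ.le] at hb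
    rw [hb]; simp
  · have h1 : b n ≤ q / ‖momentum ξ n‖ ^ 2 := by
      rw [hb, max_eq_right (by positivity)]
      exact min_le_left _ _
    rw [le_div_iff₀ (by positivity)] at h1
    nlinarith [mul_le_mul_of_nonneg_left h1 h0, mul_nonneg h0 hq.le]

theorem Iteration.inner_momentum_succ_le (hμ₀ : 0 < μ₀) (hμ₁ : 0 < μ₁) (hβ : 0 < β)
    (hF : ForwardOperator R σ domF F y L x₀ ξ₀ ρ η Lmax)
    (hx : Iteration R F y L ξ₀ σ η Lmax μ₀ μ₁ β ξ x α b γ) {n : ℕ}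
    (hn : x n ∈ closedBall x₀ (2 * ρ)) {z : X} (hz : z ∈ closedBall x₀ (2 * ρ)) (hFz : F z = y)
    (hγ : inner ℝ (momentum ξ n) (x n - z) ≤ γ n) :
    inner ℝ (momentum ξ (n + 1)) (x n - z)
      ≤ b n * γ n - (1 - η) * α n * ‖residual F y x n‖ ^ 2 := by
  rw [hx.momentum_succ, inner_sub_left, real_inner_smul_left, real_inner_smul_left, inner_gradient]
  have h1 := mul_le_mul_of_nonneg_left hγ (hx.coeff_nonneg hβ n)
  have h2 := mul_le_mul_of_nonneg_left (hF.inner_residual_ge hn hz hFz)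
    (hx.step_nonneg hμ₀ hμ₁ n)
  change α n * ((1 - η) * ‖residual F y x n‖ ^ 2)
    ≤ α n * inner ℝ (residual F y x n) (L (x n) (x n - z)) at h2
  linarith

/-- The recursion for `γ` is built for this: split `x (n + 1) - z` at `x n`. The first part is
computable, and the second is bounded by the previous `γ` and the cone condition. -/
theorem Iteration.inner_momentum_le (hμ₀ : 0 < μ₀) (hμ₁ : 0 < μ₁) (hβ : 0 < β)
    (hF : ForwardOperator R σ domF F y L x₀ ξ₀ ρ η Lmax)
    (hx : Iteration R F y L ξ₀ σ η Lmax μ₀ μ₁ β ξ x α b γ) {n : ℕ}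
    (hn : ∀ k < n, x k ∈ closedBall x₀ (2 * ρ)) {z : X} (hz : z ∈ closedBall x₀ (2 * ρ))
    (hFz : F z = y) : inner ℝ (momentum ξ n) (x n - z) ≤ γ n := by
  induction n with
  | zero => rw [hx.gamma_zero, show momentum ξ 0 = 0 from rfl, inner_zero_left]
  | succ n ih =>
    have h1 := hx.inner_momentum_succ_le hμ₀ hμ₁ hβ hF (hn n n.lt_succ_self) hz hFz
      (ih fun k hk => hn k (hk.trans n.lt_succ_self))
    rw [hx.gamma_succ n, show x (n + 1) - z = (x (n + 1) - x n) + (x n - z) by abel,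
      inner_add_right]
    linarith

/-- Monotonicity of the Bregman distance to solutions along the iteration. -/
theorem Iteration.realBregman_succ_le (hR : RegFunctional R σ) (hμ₀ : 0 < μ₀) (hμ₁ : 0 < μ₁)
    (hβ : 0 < β) (hF : ForwardOperator R σ domF F y L x₀ ξ₀ ρ η Lmax)
    (hx : Iteration R F y L ξ₀ σ η Lmax μ₀ μ₁ β ξ x α b γ) {n : ℕ}
    (hn : ∀ k ≤ n, x k ∈ closedBall x₀ (2 * ρ)) {z : X} (hz : z ∈ closedBall x₀ (2 * ρ))
    (hFz : F z = y) :
    realBregman R (ξ (n + 1)) z (x (n + 1)) ≤ realBregman R (ξ n) z (x n)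
      - (1 - η - μ₀ / (4 * σ)) * (α n * ‖residual F y x n‖ ^ 2) := by
  have hσ := hR.sigma_pos
  have h1 := hR.realBregman_succ_le z (hx.mem_subdifferential hR hF n)
    (hx.mem_subdifferential hR hF (n + 1))
  have h2 := hx.inner_momentum_succ_le hμ₀ hμ₁ hβ hF (hn n le_rfl) hz hFz
    (hx.inner_momentum_le hμ₀ hμ₁ hβ hF (fun k hk => hn k hk.le) hz hFz)
  have h3 := mul_le_mul_of_nonneg_left (hx.step_mul_norm_gradient_le hμ₀ hF (hn n le_rfl))
    (hx.step_nonneg hμ₀ hμ₁ n)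
  have h4 := hx.coeff_spec hβ n
  have h5 : ‖momentum ξ (n + 1)‖ ^ 2 = b n ^ 2 * ‖momentum ξ n‖ ^ 2
      - 2 * b n * (α n * inner ℝ (gradient F y L x n) (momentum ξ n))
      + α n * (α n * ‖gradient F y L x n‖ ^ 2) := by
    rw [hx.momentum_succ, norm_sub_sq_real, norm_smul, norm_smul, mul_pow, mul_pow,
      real_inner_smul_left, real_inner_smul_right, real_inner_comm]
    simp only [Real.norm_eq_abs, sq_abs]
    ring
  change _ ≤ _ + inner ℝ (momentum ξ (n + 1)) (x n - z) + ‖momentum ξ (n + 1)‖ ^ 2 / (4 * σ) at h1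
  -- The choice of `b n` makes the momentum terms contribute at most `-(b n * γ n)`, which cancels
  -- the `b n * γ n` in `h2`.
  have h6 : ‖momentum ξ (n + 1)‖ ^ 2 / (4 * σ)
      ≤ -(b n * γ n) + μ₀ / (4 * σ) * (α n * ‖residual F y x n‖ ^ 2) := by
    rw [div_le_iff₀ (by positivity)]
    have h7 : μ₀ / (4 * σ) * (α n * ‖residual F y x n‖ ^ 2) * (4 * σ)
      = α n * (μ₀ * ‖residual F y x n‖ ^ 2) := by field_simp
    rw [add_mul, h7]
    linarith
  linarith

end Main

/-- A positive null sequence attains running minima arbitrarily late. -/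
theorem exists_running_min {s : ℕ → ℝ} (hs : ∀ n, 0 < s n) (h : Tendsto s atTop (𝓝 0)) (N : ℕ) :
    ∃ n ≥ N, ∀ j ≤ n, s n ≤ s j := by
  obtain ⟨j₀, -, hj₀⟩ := Finset.exists_min_image (Finset.range (N + 1)) s ⟨0, by simp⟩
  -- `s K` is below every value up to `N`, so a minimizer over indices up to `K` cannot come before
  -- `N`.
  obtain ⟨K, hK⟩ := (h.eventually (gt_mem_nhds (hs j₀))).exists
  obtain ⟨n, hn, hmin⟩ := Finset.exists_min_image (Finset.range (K + 1)) s ⟨0, by simp⟩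
  have hn' := Finset.mem_range_succ_iff.1 hn
  refine ⟨n, ?_, fun j hj => hmin j (Finset.mem_range_succ_iff.2 (hj.trans hn'))⟩
  by_contra! hlt
  have h1 := hj₀ n (Finset.mem_range_succ_iff.2 hlt.le)
  have h2 := hmin K (Finset.self_mem_range_succ K)
  linarith

/-! ### Global estimates and convergence of the iterates -/

section Convergence

variable {X Y : Type*} [NormedAddCommGroup X] [InnerProductSpace ℝ X] [CompleteSpace X]
  [NormedAddCommGroup Y] [InnerProductSpace ℝ Y] [CompleteSpace Y]
  {R : X → EReal} {σ : ℝ} {domF : Set X} {F : X → Y} {y : Y} {L : X → X →L[ℝ] Y} {x₀ ξ₀ : X}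
  {ρ η Lmax μ₀ μ₁ β : ℝ} {ξ x : ℕ → X} {α b γ : ℕ → ℝ}

theorem descent_const_pos (hσ : 0 < σ) (hμ₀' : μ₀ < 4 * σ * (1 - η)) :
    0 < 1 - η - μ₀ / (4 * σ) := by
  have : μ₀ / (4 * σ) < 1 - η := by
    rw [div_lt_iff₀ (by positivity)]
    linarith
  linarith

theorem Iteration.mem_closedBall (hR : RegFunctional R σ) (hμ₀ : 0 < μ₀)
    (hμ₀' : μ₀ < 4 * σ * (1 - η)) (hμ₁ : 0 < μ₁)
    (hβ : 0 < β) (hF : ForwardOperator R σ domF F y L x₀ ξ₀ ρ η Lmax)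
    (hx : Iteration R F y L ξ₀ σ η Lmax μ₀ μ₁ β ξ x α b γ) (n : ℕ) :
    x n ∈ closedBall x₀ (2 * ρ) := by
  obtain ⟨p, hpdom, hFp, hpR, hple, hpball⟩ := hF.exists_solution_real hR
  have hρ := hF.rho_pos
  have hc := descent_const_pos hR.sigma_pos hμ₀'
  -- Descent needs all earlier iterates in the ball, so both facts are proved together. The Bregman
  -- bound puts `x n` within `ρ` of `p`, which is itself within `ρ` of `x₀`.
  suffices h : ∀ n, (∀ k ≤ n, x k ∈ closedBall x₀ (2 * ρ)) ∧
      realBregman R (ξ n) p (x n) ≤ σ * ρ ^ 2 from (h n).1 n le_rfl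
  intro n
  induction n with
  | zero =>
    rw [hx.init, hx.x_zero hR hF]
    refine ⟨fun k hk => ?_, hple⟩
    rw [Nat.le_zero.1 hk, hx.x_zero hR hF]
    exact mem_closedBall_self (by positivity)
  | succ n ih =>
    have h1 := hx.realBregman_succ_le hR hμ₀ hμ₁ hβ hF ih.1 (hF.closedBall_subset_two hpball) hFp
    have h2 : 0 ≤ (1 - η - μ₀ / (4 * σ)) * (α n * ‖residual F y x n‖ ^ 2) :=
      mul_nonneg hc.le (mul_nonneg (hx.step_nonneg hμ₀ hμ₁ n) (sq_nonneg _))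
    have h3 : realBregman R (ξ (n + 1)) p (x (n + 1)) ≤ σ * ρ ^ 2 := by linarith [ih.2]
    refine ⟨fun k hk => ?_, h3⟩
    rcases Nat.le_succ_iff.1 hk with hk | rfl
    · exact ih.1 k hk
    have h4 := (hR.norm_sq_le_realBregman (hx.mem_subdifferential hR hF _) hpR).trans h3
    have h5 := le_of_sq_le_sq (le_of_mul_le_mul_left h4 hR.sigma_pos) hρ.le
    rw [Metric.mem_closedBall] at hpball ⊢
    rw [← dist_eq_norm, dist_comm] at h5
    linarith [dist_triangle (x (n + 1)) p x₀]

theorem Iteration.antitone_realBregman (hR : RegFunctional R σ) (hμ₀ : 0 < μ₀)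
    (hμ₀' : μ₀ < 4 * σ * (1 - η)) (hμ₁ : 0 < μ₁)
    (hβ : 0 < β) (hF : ForwardOperator R σ domF F y L x₀ ξ₀ ρ η Lmax)
    (hx : Iteration R F y L ξ₀ σ η Lmax μ₀ μ₁ β ξ x α b γ) {z : X}
    (hz : z ∈ closedBall x₀ (2 * ρ)) (hFz : F z = y) :
    Antitone fun n => realBregman R (ξ n) z (x n) := by
  refine antitone_nat_of_succ_le fun n => ?_
  have h1 := hx.realBregman_succ_le hR hμ₀ hμ₁ hβ hF
    (fun k (_ : k ≤ n) => hx.mem_closedBall hR hμ₀ hμ₀' hμ₁ hβ hF k) hz hFz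
  have h2 : 0 ≤ (1 - η - μ₀ / (4 * σ)) * (α n * ‖residual F y x n‖ ^ 2) :=
    mul_nonneg (descent_const_pos hR.sigma_pos hμ₀').le
      (mul_nonneg (hx.step_nonneg hμ₀ hμ₁ n) (sq_nonneg _))
  linarith

theorem Iteration.summable_step (hR : RegFunctional R σ) (hμ₀ : 0 < μ₀)
    (hμ₀' : μ₀ < 4 * σ * (1 - η)) (hμ₁ : 0 < μ₁)
    (hβ : 0 < β) (hF : ForwardOperator R σ domF F y L x₀ ξ₀ ρ η Lmax)
    (hx : Iteration R F y L ξ₀ σ η Lmax μ₀ μ₁ β ξ x α b γ) :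
    Summable fun n => α n * ‖residual F y x n‖ ^ 2 := by
  obtain ⟨p, hpdom, hFp, hpR, hple, hpball⟩ := hF.exists_solution_real hR
  have hc := descent_const_pos hR.sigma_pos hμ₀'
  refine summable_of_sum_range_le
    (c := realBregman R (ξ 0) p (x 0) / (1 - η - μ₀ / (4 * σ)))
    (fun n => mul_nonneg (hx.step_nonneg hμ₀ hμ₁ n) (sq_nonneg _)) fun n => ?_
  have h : realBregman R (ξ n) p (x n) + (1 - η - μ₀ / (4 * σ)) *
      ∑ i ∈ Finset.range n, α i * ‖residual F y x i‖ ^ 2 ≤ realBregman R (ξ 0) p (x 0) := by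
    induction n with
    | zero => simp
    | succ n ih =>
      have h1 := hx.realBregman_succ_le hR hμ₀ hμ₁ hβ hF
        (fun k (_ : k ≤ n) => hx.mem_closedBall hR hμ₀ hμ₀' hμ₁ hβ hF k)
        (hF.closedBall_subset_two hpball) hFp
      rw [Finset.sum_range_succ, mul_add]
      linarith
  rw [le_div_iff₀ hc]
  linarith [hR.realBregman_nonneg (hx.mem_subdifferential hR hF n) hpR]

theorem Iteration.tendsto_norm_residual (hR : RegFunctional R σ) (hμ₀ : 0 < μ₀)
    (hμ₀' : μ₀ < 4 * σ * (1 - η)) (hμ₁ : 0 < μ₁)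
    (hβ : 0 < β) (hF : ForwardOperator R σ domF F y L x₀ ξ₀ ρ η Lmax)
    (hx : Iteration R F y L ξ₀ σ η Lmax μ₀ μ₁ β ξ x α b γ) :
    Tendsto (fun n => ‖residual F y x n‖) atTop (𝓝 0) := by
  have hL := hF.Lmax_pos
  have hc : 0 < min (μ₀ / Lmax ^ 2) μ₁ := lt_min (by positivity) hμ₁
  have h1 := (hx.summable_step hR hμ₀ hμ₀' hμ₁ hβ hF).tendsto_atTop_zero
  have h2 : Tendsto (fun n => ‖residual F y x n‖ ^ 2) atTop (𝓝 0) := by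
    refine squeeze_zero (fun n => sq_nonneg _) (fun n => ?_)
      (by simpa using h1.div_const (min (μ₀ / Lmax ^ 2) μ₁))
    rw [le_div_iff₀' hc]
    exact hx.norm_residual_le hR hμ₀ hF (hx.mem_closedBall hR hμ₀ hμ₀' hμ₁ hβ hF n)
  simpa [Real.sqrt_sq] using h2.sqrt

/-- Once the residual vanishes, the iterates are constant. -/
theorem Iteration.eq_of_residual_eq_zero (hR : RegFunctional R σ) (hμ₀ : 0 < μ₀)
    (hμ₀' : μ₀ < 4 * σ * (1 - η)) (hμ₁ : 0 < μ₁)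
    (hβ : 0 < β) (hF : ForwardOperator R σ domF F y L x₀ ξ₀ ρ η Lmax)
    (hx : Iteration R F y L ξ₀ σ η Lmax μ₀ μ₁ β ξ x α b γ) {N n : ℕ}
    (hN : residual F y x N = 0) (hn : N ≤ n) : x n = x N := by
  -- Here `x N` is itself a solution, so its Bregman distance to later iterates cannot rise above
  -- zero.
  have h1 := hx.antitone_realBregman hR hμ₀ hμ₀' hμ₁ hβ hF
    (hx.mem_closedBall hR hμ₀ hμ₀' hμ₁ hβ hF N) (sub_eq_zero.1 hN) hn
  have h2 := (hR.norm_sq_le_realBregman (hx.mem_subdifferential hR hF n)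
    (hR.ne_top_of_mem_subdifferential (hx.mem_subdifferential hR hF N))).trans h1
  have h3 : realBregman R (ξ N) (x N) (x N) = σ * 0 := by simp [realBregman]
  replace h2 := h2.trans_eq h3
  have h4 := le_of_mul_le_mul_left h2 hR.sigma_pos
  have h5 := pow_eq_zero_iff two_ne_zero |>.1 (le_antisymm h4 (sq_nonneg _))
  exact (sub_eq_zero.1 (norm_eq_zero.1 h5)).symm

theorem Iteration.exists_residual_running_min (hR : RegFunctional R σ) (hμ₀ : 0 < μ₀)
    (hμ₀' : μ₀ < 4 * σ * (1 - η)) (hμ₁ : 0 < μ₁)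
    (hβ : 0 < β) (hF : ForwardOperator R σ domF F y L x₀ ξ₀ ρ η Lmax)
    (hx : Iteration R F y L ξ₀ σ η Lmax μ₀ μ₁ β ξ x α b γ) (N : ℕ) :
    ∃ n ≥ N, ∀ j ≤ n, ‖residual F y x n‖ ≤ ‖residual F y x j‖ := by
  by_cases h : ∃ M, residual F y x M = 0
  · obtain ⟨M, hM⟩ := h
    refine ⟨max N M, le_max_left _ _, fun j _ => ?_⟩
    have h1 := hx.eq_of_residual_eq_zero hR hμ₀ hμ₀' hμ₁ hβ hF hM (le_max_right N M)
    have h2 : residual F y x (max N M) = 0 := by rw [residual, h1]; exact hM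
    rw [h2, norm_zero]
    exact norm_nonneg _
  · push Not at h
    exact exists_running_min (fun n => norm_pos_iff.2 (h n))
      (hx.tendsto_norm_residual hR hμ₀ hμ₀' hμ₁ hβ hF) N

/-- Splitting `x n - p` at `x i` and using `‖r_n‖ ≤ ‖r_i‖` bounds `L (x i) (x n - p)` by `(1 + η)(2
+ 1)‖r_i‖`. The momentum recursion with coefficients at most `β` then follows that of `A`. The bound
does not depend on `n`. -/
theorem Iteration.abs_inner_momentum_le (hR : RegFunctional R σ) (hμ₀ : 0 < μ₀)
    (hμ₀' : μ₀ < 4 * σ * (1 - η)) (hμ₁ : 0 < μ₁)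
    (hβ : 0 < β) (hF : ForwardOperator R σ domF F y L x₀ ξ₀ ρ η Lmax)
    (hx : Iteration R F y L ξ₀ σ η Lmax μ₀ μ₁ β ξ x α b γ) {p : X}
    (hp : p ∈ closedBall x₀ (2 * ρ)) (hFp : F p = y) {A : ℕ → ℝ} (hA₀ : A 0 = 0)
    (hA' : ∀ n, A (n + 1) = β * A n + α n * ‖residual F y x n‖ ^ 2) {n : ℕ}
    (hn : ∀ j ≤ n, ‖residual F y x n‖ ≤ ‖residual F y x j‖) {i : ℕ} (hi : i ≤ n) :
    |inner ℝ (momentum ξ i) (x n - p)| ≤ 3 * (1 + η) * A i := by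
  have hη := hF.eta_nonneg
  have hball := hx.mem_closedBall hR hμ₀ hμ₀' hμ₁ hβ hF
  induction i with
  | zero => rw [show momentum ξ 0 = 0 from rfl, hA₀]; simp
  | succ i ih =>
    have hi' : i ≤ n := i.le_succ.trans hi
    have h1 : ‖L (x i) (x n - p)‖ ≤ 3 * (1 + η) * ‖residual F y x i‖ := by
      have e1 := hF.norm_apply_le (hball i) (hball n)
      have e2 := hF.norm_apply_le (hball i) hp
      have e3 : L (x i) (x n - p) = L (x i) (x n - x i) - L (x i) (p - x i) := by
        rw [← map_sub]; congr 1; abel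
      have e4 : F (x n) - F (x i) = residual F y x n - residual F y x i := by
        simp only [residual]; abel
      have e5 : ‖F p - F (x i)‖ = ‖residual F y x i‖ := by rw [hFp, norm_sub_rev]; rfl
      have e6 : ‖F (x n) - F (x i)‖ ≤ 2 * ‖residual F y x i‖ := by
        rw [e4]
        linarith [norm_sub_le (residual F y x n) (residual F y x i), hn i hi']
      have e7 := mul_le_mul_of_nonneg_left e6 (show 0 ≤ 1 + η by linarith)
      rw [e5] at e2
      rw [e3]
      linarith [norm_sub_le (L (x i) (x n - x i)) (L (x i) (p - x i))]
    have h2 : |inner ℝ (residual F y x i) (L (x i) (x n - p))|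
        ≤ 3 * (1 + η) * ‖residual F y x i‖ ^ 2 := by
      refine (abs_real_inner_le_norm _ _).trans ?_
      have := mul_le_mul_of_nonneg_left h1 (norm_nonneg (residual F y x i))
      linarith
    have hα := hx.step_nonneg hμ₀ hμ₁ i
    have hb := hx.coeff_nonneg hβ i
    rw [hx.momentum_succ, inner_sub_left, real_inner_smul_left, real_inner_smul_left,
      inner_gradient, hA']
    refine (abs_sub _ _).trans ?_
    rw [abs_mul, abs_mul, abs_of_nonneg hα, abs_of_nonneg hb]
    have h3 := mul_le_mul (hx.coeff_le hβ i) (ih hi') (abs_nonneg _) hβ.le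
    have h4 := mul_le_mul_of_nonneg_left h2 hα
    linarith

/-- The iterates at which the residual attains a running minimum approximate all late iterates in
the Bregman distance. -/
theorem Iteration.exists_realBregman_le (hR : RegFunctional R σ) (hμ₀ : 0 < μ₀)
    (hμ₀' : μ₀ < 4 * σ * (1 - η)) (hμ₁ : 0 < μ₁)
    (hβ : 0 < β) (hβ' : β < 1) (hF : ForwardOperator R σ domF F y L x₀ ξ₀ ρ η Lmax)
    (hx : Iteration R F y L ξ₀ σ η Lmax μ₀ μ₁ β ξ x α b γ) {ε : ℝ} (hε : 0 < ε) :
    ∃ N, ∀ M, ∃ n ≥ M, ∀ m, N ≤ m → m ≤ n → realBregman R (ξ m) (x n) (x m) ≤ ε := by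
  obtain ⟨p, hpdom, hFp, hpR, hple, hpball⟩ := hF.exists_solution_real hR
  have hp := hF.closedBall_subset_two hpball
  obtain ⟨A, hA₀, hA', hAs⟩ := exists_summable_recursion hβ.le hβ'
    (fun n => mul_nonneg (hx.step_nonneg hμ₀ hμ₁ n) (sq_nonneg ‖residual F y x n‖))
    (hx.summable_step hR hμ₀ hμ₀' hμ₁ hβ hF)
  -- Chosen so that the wanted Bregman distance is at most `E m - E n`. It converges, being a
  -- decreasing nonnegative sequence minus partial sums of a convergent series.
  set E : ℕ → ℝ := fun k => realBregman R (ξ k) p (x k)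
    - 3 * (1 + η) * ∑ i ∈ Finset.range (k + 1), A i with hE
  have hEcau : CauchySeq E := by
    have h1 := tendsto_atTop_ciInf (hx.antitone_realBregman hR hμ₀ hμ₀' hμ₁ hβ hF hp hFp) ⟨0, by
      rintro _ ⟨n, rfl⟩
      exact hR.realBregman_nonneg (hx.mem_subdifferential hR hF n) hpR⟩
    exact (h1.sub (((tendsto_add_atTop_iff_nat 1).2 hAs.hasSum.tendsto_sum_nat).const_mul
      (3 * (1 + η)))).cauchySeq
  obtain ⟨N, hN⟩ := Metric.cauchySeq_iff.1 hEcau ε hε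
  refine ⟨N, fun M => ?_⟩
  obtain ⟨n, hnM, hn⟩ := hx.exists_residual_running_min hR hμ₀ hμ₀' hμ₁ hβ hF M
  refine ⟨n, hnM, fun m hm hmn => ?_⟩
  have key : ∀ k, m ≤ k → k ≤ n → inner ℝ (ξ k - ξ m) (x n - p) ≤ 3 * (1 + η) *
      (∑ i ∈ Finset.range (k + 1), A i - ∑ i ∈ Finset.range (m + 1), A i) := by
    intro k hmk
    induction k, hmk using Nat.le_induction with
    | base => simp
    | succ k hmk ih =>
      intro hk
      have h1 := ih (k.le_succ.trans hk)
      have h2 := le_of_abs_le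
        (hx.abs_inner_momentum_le hR hμ₀ hμ₀' hμ₁ hβ hF hp hFp hA₀ hA' hn hk)
      change inner ℝ (ξ (k + 1) - ξ k) (x n - p) ≤ _ at h2
      rw [Finset.sum_range_succ _ (k + 1),
        show ξ (k + 1) - ξ m = (ξ (k + 1) - ξ k) + (ξ k - ξ m) by abel, inner_add_left]
      linarith
  have h1 := key n hmn le_rfl
  have h2 := le_of_abs_le (hN m hm n (hm.trans hmn)).le
  simp only [hE, realBregman, inner_sub_left, inner_sub_right] at h1 h2 ⊢
  linarith

theorem Iteration.cauchySeq (hR : RegFunctional R σ) (hμ₀ : 0 < μ₀)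
    (hμ₀' : μ₀ < 4 * σ * (1 - η)) (hμ₁ : 0 < μ₁)
    (hβ : 0 < β) (hβ' : β < 1) (hF : ForwardOperator R σ domF F y L x₀ ξ₀ ρ η Lmax)
    (hx : Iteration R F y L ξ₀ σ η Lmax μ₀ μ₁ β ξ x α b γ) : CauchySeq x := by
  have hσ := hR.sigma_pos
  rw [Metric.cauchySeq_iff]
  intro ε hε
  obtain ⟨N, hN⟩ := hx.exists_realBregman_le hR hμ₀ hμ₀' hμ₁ hβ hβ' hF
    (ε := σ * (ε / 3) ^ 2) (by positivity)
  refine ⟨N, fun m hm k hk => ?_⟩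
  obtain ⟨n, hn, hle⟩ := hN (max m k)
  -- Two arbitrary late iterates are compared through a running-minimum iterate `x n` beyond both.
  have key : ∀ i, N ≤ i → i ≤ n → dist (x n) (x i) ≤ ε / 3 := by
    intro i hi hin
    have h1 := (hR.norm_sq_le_realBregman (hx.mem_subdifferential hR hF i)
      (hR.ne_top_of_mem_subdifferential (hx.mem_subdifferential hR hF n))).trans (hle i hi hin)
    rw [dist_eq_norm]
    exact le_of_sq_le_sq (le_of_mul_le_mul_left h1 hσ) (by positivity)
  have h1 := key m hm ((le_max_left _ _).trans hn)
  have h2 := key k hk ((le_max_right _ _).trans hn)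
  linarith [dist_triangle_left (x m) (x k) (x n)]

/-- The Bregman distances of the limit to the iterates tend to zero. -/
theorem Iteration.tendsto_realBregman (hR : RegFunctional R σ) (hμ₀ : 0 < μ₀)
    (hμ₀' : μ₀ < 4 * σ * (1 - η)) (hμ₁ : 0 < μ₁)
    (hβ : 0 < β) (hβ' : β < 1) (hF : ForwardOperator R σ domF F y L x₀ ξ₀ ρ η Lmax)
    (hx : Iteration R F y L ξ₀ σ η Lmax μ₀ μ₁ β ξ x α b γ) {z : X}
    (hz : Tendsto x atTop (𝓝 z)) :
    R z ≠ ⊤ ∧ Tendsto (fun n => realBregman R (ξ n) z (x n)) atTop (𝓝 0) := by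
  have hdom : ∀ n, R (x n) ≠ ⊤ := fun n =>
    hR.ne_top_of_mem_subdifferential (hx.mem_subdifferential hR hF n)
  -- Fix `m` and let the running-minimum index tend to infinity; lower semicontinuity gives both `R
  -- z ≠ ⊤` and a bound on the Bregman distance.
  have key : ∀ ε > 0, ∃ N, ∀ m ≥ N,
      R z ≤ (((R (x m)).toReal + inner ℝ (ξ m) (z - x m) + ε : ℝ) : EReal) := by
    intro ε hε
    obtain ⟨N, hN⟩ := hx.exists_realBregman_le hR hμ₀ hμ₀' hμ₁ hβ hβ' hF hε
    refine ⟨N, fun m hm => ?_⟩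
    choose n hn hle using hN
    have hn' : Tendsto n atTop atTop := tendsto_atTop_mono hn tendsto_id
    refine hR.le_of_tendsto (hz.comp hn') (((tendsto_const_nhds (x := (R (x m)).toReal)).add
      (tendsto_const_nhds.inner ((hz.comp hn').sub_const (x m)))).add_const ε) ?_
    filter_upwards [eventually_ge_atTop m] with M hM
    have := hle M m hm (hM.trans (hn M))
    rw [Function.comp_apply, ← hR.coe_toReal (hdom (n M)), EReal.coe_le_coe_iff]
    simp only [realBregman] at this
    linarith
  have hzR : R z ≠ ⊤ := by
    obtain ⟨N, hN⟩ := key 1 one_pos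
    intro htop
    have := hN N le_rfl
    rw [htop, top_le_iff] at this
    exact EReal.coe_ne_top _ this
  refine ⟨hzR, ?_⟩
  rw [Metric.tendsto_atTop]
  intro ε hε
  obtain ⟨N, hN⟩ := key (ε / 2) (half_pos hε)
  refine ⟨N, fun m hm => ?_⟩
  have h1 := hN m hm
  rw [← hR.coe_toReal hzR, EReal.coe_le_coe_iff] at h1
  have h2 := hR.realBregman_nonneg (hx.mem_subdifferential hR hF m) hzR
  rw [Real.dist_eq, sub_zero, abs_of_nonneg h2]
  simp only [realBregman]
  linarith

/-- Directions in the kernels of all linearizations are orthogonal to the dual increments. -/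
theorem Iteration.inner_dual_sub_eq_zero
    (hx : Iteration R F y L ξ₀ σ η Lmax μ₀ μ₁ β ξ x α b γ) {v : X}
    (hv : ∀ n, L (x n) v = 0) (n : ℕ) : inner ℝ (ξ n - ξ₀) v = 0 := by
  have hm : ∀ n, inner ℝ (momentum ξ n) v = 0 := by
    intro n
    induction n with
    | zero => exact inner_zero_left v
    | succ n ih =>
      rw [hx.momentum_succ, inner_sub_left, real_inner_smul_left, real_inner_smul_left,
        inner_gradient, hv, ih, inner_zero_right, mul_zero, mul_zero, sub_zero]
  induction n with
  | zero => rw [hx.init, sub_self, inner_zero_left]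
  | succ n ih =>
    rw [show ξ (n + 1) - ξ₀ = momentum ξ (n + 1) + (ξ n - ξ₀) by
      rw [show momentum ξ (n + 1) = ξ (n + 1) - ξ n from rfl]; abel, inner_add_left, hm, ih,
      add_zero]

end Convergence

end AHB

/-! ### The main theorem -/

theorem mainTheorem2 {X Y : Type*}
    [NormedAddCommGroup X] [InnerProductSpace ℝ X] [CompleteSpace X]
    [NormedAddCommGroup Y] [InnerProductSpace ℝ Y] [CompleteSpace Y]
    (R : X → EReal) (σ : ℝ) (hR : AHB.RegFunctional R σ)
    (domF : Set X) (F : X → Y) (y : Y) (L : X → X →L[ℝ] Y) (x₀ ξ₀ : X) (ρ η Lmax : ℝ)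
    (hF : AHB.ForwardOperator R σ domF F y L x₀ ξ₀ ρ η Lmax)
    (μ₀ μ₁ β : ℝ) (hμ₀ : 0 < μ₀) (hμ₀' : μ₀ < 4 * σ * (1 - η)) (hμ₁ : 0 < μ₁)
    (hβ : 0 < β) (hβ' : β < 1)
    (ξ x : ℕ → X) (α b γ : ℕ → ℝ)
    (hx : AHB.Iteration R F y L ξ₀ σ η Lmax μ₀ μ₁ β ξ x α b γ) :
    -- the objects in the statement are well defined
    (∀ n, (∃! z, AHB.IsMinimizer R (ξ n) z) ∧ x n ∈ Metric.closedBall x₀ (2 * ρ)) ∧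
    (∃! xdag, AHB.IsMinimalSolution R domF F y x₀ ξ₀ xdag) ∧
    -- strong convergence
    ∃ xstar ∈ Metric.closedBall x₀ (2 * ρ), xstar ∈ domF ∧ F xstar = y ∧
      Filter.Tendsto (fun n => AHB.bregman R (ξ n) xstar (x n)) Filter.atTop (nhds 0) ∧
      Filter.Tendsto (fun n => ‖x n - xstar‖) Filter.atTop (nhds 0) ∧
      ∀ xdag, AHB.IsMinimalSolution R domF F y x₀ ξ₀ xdag →
        (∀ z ∈ Metric.closedBall x₀ (2 * ρ), (L xdag).ker ≤ (L z).ker) → xstar = xdag := by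
  have hball := hx.mem_closedBall hR hμ₀ hμ₀' hμ₁ hβ hF
  refine ⟨fun n => ⟨hR.existsUnique_isMinimizer hF.subgradient _, hball n⟩,
    hF.existsUnique_isMinimalSolution hR, ?_⟩
  obtain ⟨z, hz⟩ := cauchySeq_tendsto_of_complete (hx.cauchySeq hR hμ₀ hμ₀' hμ₁ hβ hβ' hF)
  have hzball : z ∈ closedBall x₀ (2 * ρ) :=
    isClosed_closedBall.mem_of_tendsto hz (Eventually.of_forall hball)
  have hFx : Tendsto (fun n => F (x n)) atTop (𝓝 y) :=
    tendsto_iff_norm_sub_tendsto_zero.2 (hx.tendsto_norm_residual hR hμ₀ hμ₀' hμ₁ hβ hF)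
  obtain ⟨hzdom, hFz⟩ := hF.weakly_closed x z y (fun n => hF.ball_subset (hball n))
    (((toWeakSpaceCLM ℝ X).continuous.tendsto z).comp hz) hFx
  obtain ⟨hzR, hlim⟩ := hx.tendsto_realBregman hR hμ₀ hμ₀' hμ₁ hβ hβ' hF hz
  have hsub := hx.mem_subdifferential hR hF
  refine ⟨z, hzball, hzdom, hFz, ?_, tendsto_iff_norm_sub_tendsto_zero.1 hz, fun w hw hker => ?_⟩
  · refine Tendsto.congr (fun n =>
      (hR.bregman_eq (hR.ne_top_of_mem_subdifferential (hsub n)) hzR (ξ n)).symm) ?_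
    exact (continuous_coe_real_ereal.tendsto 0).comp hlim
  · refine (hF.existsUnique_isMinimalSolution hR).unique ⟨hzdom, hFz, fun u hu hFu => ?_⟩ hw
    refine le_trans ?_ (hw.2.2 u hu hFu)
    obtain ⟨⟨hwball, hFw⟩, hwR, -⟩ := (hF.isMinimalSolution_iff hR).1 hw
    have hx₀ := hR.ne_top_of_mem_subdifferential hF.subgradient
    have hwball' := hF.closedBall_subset_two hwball
    have hv : L w (z - w) = 0 := (hF.solution_iff hwball' hzball hFw).1 hFz
    have horth := hx.inner_dual_sub_eq_zero (v := z - w) fun n => hker (x n) (hball n) hv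
    rw [hR.bregman_eq hx₀ hzR, hR.bregman_eq hx₀ hwR, EReal.coe_le_coe_iff, ← sub_nonpos]
    -- By orthogonality of `ξ n - ξ₀` to `z - w`, the difference of the two distances at `x₀` equals
    -- `D_n(z) - D_n(w)` for every `n`. This is at most `D_n(z)`, which tends to `0`.
    refine ge_of_tendsto hlim (Eventually.of_forall fun n => ?_)
    have h1 := horth n
    have h2 := hR.realBregman_nonneg (hsub n) hwR
    simp only [AHB.realBregman, inner_sub_left, inner_sub_right] at h1 h2 ⊢
    linarith
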